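/- Let $B_0\subset B_1$ be a connected unital inclusion of finite-dimensional $C^*$-algebras (connected means $B_0\cap B_1'=\mathbb{C}1$), and let $\mathrm{tr}$ be a faithful positive normalized trace on $B_1$ that is a Markov trace of some modulus $\tau$: it extends to a faithful positive trace on the basic construction $B_2=\{B_1,e_2\}''\subset\mathcal B(L^2(B_1,\mathrm{tr}))$, where $e_2$ is the orthogonal projection of $L^2(B_1,\mathrm{tr})$ onto $L^2(B_0,\mathrm{tr})$, with $\mathrm{tr}(xe_2)=\tau\,\mathrm{tr}(x)$ for all $x\in B_1$. Iterating the basic construction, with the traces extended in this way at each step, gives the tower $B_0\subset B_1\subset B_2\subset\cdots$ with $B_i=\{B_{i-1},e_i\}''$ for $i\ge 2$, where $e_i$ is the projection of $L^2(B_{i-1},\mathrm{tr})$ onto $L^2(B_{i-2},\mathrm{tr})$. Let $B_\infty$ be the von Neumann algebra generated by $\bigcup_i B_i$ in the GNS representation of $\mathrm{tr}$, equipped with the extended trace. Let $a$ be a trace-preserving $*$-automorphism of $B_1$ which leaves $B_0$ invariant. Then there is a unique trace-preserving $*$-automorphism $\alpha$ of $B_\infty$ such that $\alpha(e_i)=e_i$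 for all $i\ge 2$, $\alpha(B_i)=B_i$ for all $i\ge 0$, and $\alpha|_{B_1}=a$. -/

import Mathlib

open scoped ComplexOrder InnerProductSpace

universe u

namespace JonesTower

section FaithfulTrace

variable {A : Type u} [Ring A] [StarRing A] [Algebra ℂ A] [StarModule ℂ A]

/-- A normalized, positive and faithful trace on a unital complex `*`-algebra.  (`0 < z` for a
complex number `z` means that `z` is real and positive.) -/
class IsFaithfulTrace (φ : A →ₗ[ℂ] ℂ) : Prop where
  map_one : φ 1 = 1
  map_mul_comm : ∀ x y : A, φ (x * y) = φ (y * x)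
  map_star_mul_self_pos : ∀ x : A, x ≠ 0 → 0 < φ (star x * x)

theorem IsFaithfulTrace.nonneg {A : Type u} [Ring A] [StarRing A] [Algebra ℂ A] (φ : A →ₗ[ℂ] ℂ) [h : IsFaithfulTrace φ] (x : A) :
    0 ≤ φ (star x * x) := by
  by_cases hx : x = 0
  · simp [hx]
  · exact (h.map_star_mul_self_pos x hx).le

theorem IsFaithfulTrace.map_star (φ : A →ₗ[ℂ] ℂ) [h : IsFaithfulTrace φ] (x : A) :
    φ (star x) = star (φ x) := by
  have key : ∀ c : ℂ, 0 ≤ φ (star x * x) + c * φ (star x) + (star c * φ x + c * star c) := by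
    intro c
    have := IsFaithfulTrace.nonneg φ (x + algebraMap ℂ A c)
    have e : star (x + algebraMap ℂ A c) * (x + algebraMap ℂ A c) =
        star x * x + c • star x + (star c • x + (c * star c) • (1 : A)) := by
      simp only [Algebra.algebraMap_eq_smul_one, star_add, star_smul, star_one, add_mul, mul_add,
        smul_mul_assoc, one_mul, mul_smul_comm, mul_one, smul_add, smul_smul]
      abel
    rw [e] at this
    simpa [h.map_one] using this
  have h0 := (Complex.le_def.mp (IsFaithfulTrace.nonneg φ x)).2
  have h1 := (Complex.le_def.mp (key 1)).2
  have h2 := (Complex.le_def.mp (key Complex.I)).2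
  simp at h0 h1 h2
  apply Complex.ext <;> simp <;> linarith

/-- The space `A` with the inner product `⟪x, y⟫ = φ (x⋆ y)` (conjugate-linear in the first
variable) given by a faithful trace `φ`.  If `A` is finite dimensional, this is `L²(A, φ)`; in
general `L²(A, φ)` is its completion. -/
def L2 (_φ : A →ₗ[ℂ] ℂ) : Type u := A

instance (φ : A →ₗ[ℂ] ℂ) : AddCommGroup (L2 φ) := inferInstanceAs (AddCommGroup A)
instance (φ : A →ₗ[ℂ] ℂ) : Module ℂ (L2 φ) := inferInstanceAs (Module ℂ A)
instance (φ : A →ₗ[ℂ] ℂ) [FiniteDimensional ℂ A] : FiniteDimensional ℂ (L2 φ) :=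
  inferInstanceAs (FiniteDimensional ℂ A)

/-- The identity map from `A` to `L²(A, φ)`. -/
def toL2 (φ : A →ₗ[ℂ] ℂ) : A ≃ₗ[ℂ] L2 φ := LinearEquiv.refl ℂ A

noncomputable instance instCoreL2 (φ : A →ₗ[ℂ] ℂ) [IsFaithfulTrace φ] :
    InnerProductSpace.Core ℂ (L2 φ) where
  inner x y := φ (star ((toL2 φ).symm x) * (toL2 φ).symm y)
  conj_inner_symm x y := by
    have := IsFaithfulTrace.map_star φ (star ((toL2 φ).symm y) * (toL2 φ).symm x)
    simp only [star_mul, star_star] at this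
    rw [this]; rfl
  re_inner_nonneg x := (Complex.le_def.mp (IsFaithfulTrace.nonneg φ ((toL2 φ).symm x))).1
  add_left x y z := by simp [add_mul]
  smul_left x y c := by simp
  definite x hx := by
    by_contra hne
    exact (IsFaithfulTrace.map_star_mul_self_pos (φ := φ) ((toL2 φ).symm x)
      (by simpa using hne)).ne' hx

noncomputable instance (φ : A →ₗ[ℂ] ℂ) [IsFaithfulTrace φ] : NormedAddCommGroup (L2 φ) :=
  (instCoreL2 φ).toNormedAddCommGroup

noncomputable instance (φ : A →ₗ[ℂ] ℂ) [IsFaithfulTrace φ] : InnerProductSpace ℂ (L2 φ) :=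
  InnerProductSpace.ofCore (instCoreL2 φ).toCore

theorem inner_toL2 (φ : A →ₗ[ℂ] ℂ) [IsFaithfulTrace φ] (x y : A) :
    ⟪toL2 φ x, toL2 φ y⟫_ℂ = φ (star x * y) := rfl

end FaithfulTrace

section BasicConstruction

variable {A : Type u} [Ring A] [StarRing A] [Algebra ℂ A] [StarModule ℂ A]
  [FiniteDimensional ℂ A]

noncomputable instance (φ : A →ₗ[ℂ] ℂ) [IsFaithfulTrace φ] : CompleteSpace (L2 φ) :=
  FiniteDimensional.complete ℂ (L2 φ)

/-- The action of a finite dimensional `A` on `L²(A, φ)` by left multiplication. -/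
noncomputable def lmul (φ : A →ₗ[ℂ] ℂ) [IsFaithfulTrace φ] : A →⋆ₐ[ℂ] (L2 φ →L[ℂ] L2 φ) where
  toFun x := LinearMap.toContinuousLinearMap
    ((toL2 φ).toLinearMap ∘ₗ LinearMap.mulLeft ℂ x ∘ₗ (toL2 φ).symm.toLinearMap)
  map_one' := by ext; simp
  map_mul' x y := by ext; simp
  map_zero' := by ext; simp
  map_add' x y := by ext; simp [add_mul]
  commutes' c := by ext; simp [Algebra.algebraMap_eq_smul_one]
  map_star' x := by
    rw [ContinuousLinearMap.star_eq_adjoint, ContinuousLinearMap.eq_adjoint_iff]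
    intro y z
    obtain ⟨y, rfl⟩ := (toL2 φ).surjective y
    obtain ⟨z, rfl⟩ := (toL2 φ).surjective z
    simp [inner_toL2, mul_assoc]

theorem lmul_toL2 (φ : A →ₗ[ℂ] ℂ) [IsFaithfulTrace φ] (x y : A) :
    lmul φ x (toL2 φ y) = toL2 φ (x * y) := by simp [lmul]

/-- The Jones projection: the orthogonal projection of `L²(A, φ)` onto `L²(N, φ)`. -/
noncomputable def jonesProj (N : StarSubalgebra ℂ A) (φ : A →ₗ[ℂ] ℂ) [IsFaithfulTrace φ] :
    L2 φ →L[ℂ] L2 φ :=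
  (N.toSubalgebra.toSubmodule.map (toL2 φ).toLinearMap).starProjection

/-- The basic construction for `N ⊆ A`: the von Neumann algebra `{A, e}''` on `L²(A, φ)`, where
`A` acts by left multiplication and `e` is the Jones projection. -/
noncomputable def basic (N : StarSubalgebra ℂ A) (φ : A →ₗ[ℂ] ℂ) [IsFaithfulTrace φ] :
    StarSubalgebra ℂ (L2 φ →L[ℂ] L2 φ) :=
  StarSubalgebra.centralizer ℂ
    (StarSubalgebra.centralizer ℂ (Set.range (lmul φ) ∪ {jonesProj N φ}) :
      Set (L2 φ →L[ℂ] L2 φ))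

/-- The trace-preserving conditional expectation of `A` onto `N`, i.e. the Jones projection read as
a linear map on `A`. -/
noncomputable def condExp (N : StarSubalgebra ℂ A) (φ : A →ₗ[ℂ] ℂ) [IsFaithfulTrace φ] :
    A →ₗ[ℂ] A :=
  (toL2 φ).symm.toLinearMap ∘ₗ (jonesProj N φ).toLinearMap ∘ₗ (toL2 φ).toLinearMap

section Facts

variable (N : StarSubalgebra ℂ A) (φ : A →ₗ[ℂ] ℂ) [hφ : IsFaithfulTrace φ]

theorem jonesProj_toL2 (x : A) : jonesProj N φ (toL2 φ x) = toL2 φ (condExp N φ x) := by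
  simp [condExp]

theorem condExp_mem (x : A) : condExp N φ x ∈ N := by
  have h := Submodule.starProjection_apply_mem
    (N.toSubalgebra.toSubmodule.map (toL2 φ).toLinearMap) (toL2 φ x)
  obtain ⟨y, hy, hxy⟩ := h
  have : condExp N φ x = y := by
    have : toL2 φ (condExp N φ x) = toL2 φ y := by
      rw [← jonesProj_toL2]; exact hxy.symm
    exact (toL2 φ).injective this
  rw [this]; exact hy

theorem trace_mul_condExp (x : A) {n : A} (hn : n ∈ N) :
    φ (n * condExp N φ x) = φ (n * x) := by
  have h := Submodule.starProjection_inner_eq_zero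
    (K := N.toSubalgebra.toSubmodule.map (toL2 φ).toLinearMap) (toL2 φ x) (toL2 φ (star n))
    ⟨star n, N.star_mem' hn, rfl⟩
  change ⟪toL2 φ x - jonesProj N φ (toL2 φ x), toL2 φ (star n)⟫_ℂ = 0 at h
  rw [jonesProj_toL2, ← map_sub, ← inner_conj_symm, inner_toL2, star_star, mul_sub, map_sub,
    map_eq_zero, sub_eq_zero] at h
  exact h.symm

theorem condExp_unique {x y : A} (hy : y ∈ N) (h : ∀ n ∈ N, φ (n * y) = φ (n * x)) :
    condExp N φ x = y := by
  have hz : condExp N φ x - y ∈ N := sub_mem (condExp_mem N φ x) hy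
  by_contra hne
  refine (hφ.map_star_mul_self_pos _ (sub_ne_zero.mpr hne)).ne' ?_
  have hs : star (condExp N φ x - y) ∈ N := N.star_mem' hz
  rw [mul_sub, map_sub, trace_mul_condExp N φ x hs, h _ hs, sub_self]

theorem condExp_left {n : A} (hn : n ∈ N) (x : A) :
    condExp N φ (n * x) = n * condExp N φ x :=
  condExp_unique N φ (mul_mem hn (condExp_mem N φ x)) fun m hm => by
    rw [← mul_assoc, ← mul_assoc, trace_mul_condExp N φ x (mul_mem hm hn)]

theorem condExp_right {n : A} (hn : n ∈ N) (x : A) :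
    condExp N φ (x * n) = condExp N φ x * n :=
  condExp_unique N φ (mul_mem (condExp_mem N φ x) hn) fun m hm => by
    rw [← mul_assoc, hφ.map_mul_comm, ← mul_assoc, trace_mul_condExp N φ x (mul_mem hn hm),
      mul_assoc, hφ.map_mul_comm, mul_assoc]

theorem condExp_of_mem {n : A} (hn : n ∈ N) : condExp N φ n = n :=
  condExp_unique N φ hn fun _ _ => rfl

theorem trace_condExp (x : A) : φ (condExp N φ x) = φ x := by
  simpa using trace_mul_condExp N φ x (one_mem N)

theorem condExp_star (x : A) : condExp N φ (star x) = star (condExp N φ x) :=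
  condExp_unique N φ (N.star_mem' (condExp_mem N φ x)) fun m hm => by
    have := trace_mul_condExp N φ x (n := star m) (N.star_mem' hm)
    rw [hφ.map_mul_comm, ← star_star m, ← star_mul, hφ.map_star, this, ← hφ.map_star, star_mul,
      star_star, hφ.map_mul_comm]

theorem star_jonesProj : star (jonesProj N φ) = jonesProj N φ :=
  (isSelfAdjoint_starProjection _).star_eq

theorem jonesProj_mul_self : jonesProj N φ * jonesProj N φ = jonesProj N φ :=
  (Submodule.isIdempotentElem_starProjection _).eq

theorem jonesProj_lmul_jonesProj (x : A) :
    jonesProj N φ * lmul φ x * jonesProj N φ = lmul φ (condExp N φ x) * jonesProj N φ := by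
  ext y
  obtain ⟨y, rfl⟩ := (toL2 φ).surjective y
  simp [lmul_toL2, jonesProj_toL2, condExp_right N φ (condExp_mem N φ y)]

theorem lmul_jonesProj_comm {n : A} (hn : n ∈ N) :
    lmul φ n * jonesProj N φ = jonesProj N φ * lmul φ n := by
  ext y
  obtain ⟨y, rfl⟩ := (toL2 φ).surjective y
  simp [lmul_toL2, jonesProj_toL2, condExp_left N φ hn]

theorem lmul_mem_basic (x : A) : lmul φ x ∈ basic N φ := by
  refine (StarSubalgebra.mem_centralizer_iff ℂ).mpr fun g hg => ?_
  have := (StarSubalgebra.mem_centralizer_iff ℂ).mp hg (lmul φ x) (Or.inl ⟨x, rfl⟩)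
  exact ⟨this.1.symm, by
    have h2 := this.2
    have h3 := congrArg star this.2
    simp only [star_mul, star_star] at h3
    exact h3⟩

theorem jonesProj_mem_basic : jonesProj N φ ∈ basic N φ := by
  refine (StarSubalgebra.mem_centralizer_iff ℂ).mpr fun g hg => ?_
  have := (StarSubalgebra.mem_centralizer_iff ℂ).mp hg (jonesProj N φ) (Or.inr rfl)
  exact ⟨this.1.symm, by
    have h3 := congrArg star this.2
    simp only [star_mul, star_star] at h3
    exact h3⟩

/-- Right multiplication on `L²(A, φ)`. -/
noncomputable def rmul (y : A) : L2 φ →L[ℂ] L2 φ :=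
  LinearMap.toContinuousLinearMap
    ((toL2 φ).toLinearMap ∘ₗ LinearMap.mulRight ℂ y ∘ₗ (toL2 φ).symm.toLinearMap)

theorem rmul_toL2 (x y : A) : rmul φ y (toL2 φ x) = toL2 φ (x * y) := by simp [rmul]

theorem star_rmul (y : A) : star (rmul φ y) = rmul φ (star y) := by
  symm
  rw [ContinuousLinearMap.star_eq_adjoint, ContinuousLinearMap.eq_adjoint_iff]
  intro x z
  obtain ⟨x, rfl⟩ := (toL2 φ).surjective x
  obtain ⟨z, rfl⟩ := (toL2 φ).surjective z
  simp only [rmul_toL2, inner_toL2, star_mul, star_star]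
  rw [mul_assoc, hφ.map_mul_comm, mul_assoc]

theorem rmul_mem_centralizer {n : A} (hn : n ∈ N) :
    rmul φ n ∈ StarSubalgebra.centralizer ℂ (Set.range (lmul φ) ∪ {jonesProj N φ}) := by
  have key : ∀ m ∈ N, ∀ g ∈ Set.range (lmul φ) ∪ {jonesProj N φ},
      g * rmul φ m = rmul φ m * g := by
    rintro m hm g (⟨x, rfl⟩ | rfl)
    · ext y
      obtain ⟨y, rfl⟩ := (toL2 φ).surjective y
      simp [lmul_toL2, rmul_toL2, mul_assoc]
    · ext y
      obtain ⟨y, rfl⟩ := (toL2 φ).surjective y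
      simp [jonesProj_toL2, rmul_toL2, condExp_right N φ hm]
  refine (StarSubalgebra.mem_centralizer_iff ℂ).mpr fun g hg => ⟨key n hn g hg, ?_⟩
  have h := congrArg star (key (star n) (N.star_mem' hn) g hg)
  simp only [star_mul, star_rmul, star_star] at h
  exact h.symm

/-- Elements of the basic construction are right `N`-linear. -/
theorem basic_mul_right {T : L2 φ →L[ℂ] L2 φ} (hT : T ∈ basic N φ) (x : A) {n : A} (hn : n ∈ N) :
    (toL2 φ).symm (T (toL2 φ (x * n))) = (toL2 φ).symm (T (toL2 φ x)) * n := by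
  have h := ((StarSubalgebra.mem_centralizer_iff ℂ).mp hT _ (rmul_mem_centralizer N φ hn)).1
  have h' := congrArg (fun S => (toL2 φ).symm (S (toL2 φ x))) h
  simp only [mul_apply_eq_comp, rmul_toL2] at h'
  rw [← h']
  simp [rmul]

theorem basic_mul_lmul_jonesProj {T : L2 φ →L[ℂ] L2 φ} (hT : T ∈ basic N φ) (x : A) :
    T * lmul φ x * jonesProj N φ =
      lmul φ ((toL2 φ).symm (T (toL2 φ x))) * jonesProj N φ := by
  ext y
  obtain ⟨y, rfl⟩ := (toL2 φ).surjective y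
  have := basic_mul_right N φ hT x (condExp_mem N φ y)
  simp only [mul_apply_eq_comp, jonesProj_toL2, lmul_toL2]
  rw [← this]
  simp

instance isClosed_basic : IsClosed (basic N φ : Set (L2 φ →L[ℂ] L2 φ)) := by
  rw [basic, StarSubalgebra.coe_centralizer]
  exact Set.isClosed_centralizer _

instance finiteDimensional_basic : FiniteDimensional ℂ (basic N φ) := by
  have : FiniteDimensional ℂ (L2 φ →L[ℂ] L2 φ) := inferInstance
  exact FiniteDimensional.finiteDimensional_submodule (basic N φ).toSubalgebra.toSubmodule

noncomputable instance : CStarAlgebra (basic N φ) := inferInstance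

/-- The inclusion of `A` into the basic construction. -/
noncomputable def incl : A →⋆ₐ[ℂ] basic N φ :=
  (lmul φ).codRestrict (basic N φ) (lmul_mem_basic N φ)

/-- The Jones projection as an element of the basic construction. -/
noncomputable def proj : basic N φ := ⟨jonesProj N φ, jonesProj_mem_basic N φ⟩

/-- An element of the basic construction, as a map from `A` to itself. -/
noncomputable def act : basic N φ →ₗ[ℂ] A →ₗ[ℂ] A where
  toFun T := (toL2 φ).symm.toLinearMap ∘ₗ (T : L2 φ →L[ℂ] L2 φ).toLinearMap ∘ₗ
    (toL2 φ).toLinearMap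
  map_add' S T := by ext; simp
  map_smul' c T := by ext; simp

theorem toL2_act (T : basic N φ) (x : A) :
    toL2 φ (act N φ T x) = (T : L2 φ →L[ℂ] L2 φ) (toL2 φ x) := by simp [act]

theorem act_mul (S T : basic N φ) (x : A) : act N φ (S * T) x = act N φ S (act N φ T x) := by
  simp [act]

theorem act_incl (a x : A) : act N φ (incl N φ a) x = a * x := by
  apply (toL2 φ).injective
  rw [toL2_act]; exact lmul_toL2 φ a x

theorem act_proj (x : A) : act N φ (proj N φ) x = condExp N φ x := by
  apply (toL2 φ).injective
  rw [toL2_act]; exact jonesProj_toL2 N φ x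

theorem act_ext {S T : basic N φ} (h : ∀ x, act N φ S x = act N φ T x) : S = T := by
  apply Subtype.ext
  ext y
  obtain ⟨y, rfl⟩ := (toL2 φ).surjective y
  rw [← toL2_act, ← toL2_act, h]

theorem mul_incl_proj (T : basic N φ) (x : A) :
    T * incl N φ x * proj N φ = incl N φ (act N φ T x) * proj N φ :=
  Subtype.ext (basic_mul_lmul_jonesProj N φ T.2 x)

theorem star_proj : star (proj N φ) = proj N φ := Subtype.ext (star_jonesProj N φ)

theorem proj_mul_self : proj N φ * proj N φ = proj N φ := Subtype.ext (jonesProj_mul_self N φ)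

theorem proj_incl_proj (x : A) :
    proj N φ * incl N φ x * proj N φ = incl N φ (condExp N φ x) * proj N φ :=
  Subtype.ext (jonesProj_lmul_jonesProj N φ x)

theorem incl_proj_comm {n : A} (hn : n ∈ N) :
    incl N φ n * proj N φ = proj N φ * incl N φ n :=
  Subtype.ext (lmul_jonesProj_comm N φ hn)

theorem trace_condExp_mul (x : A) {n : A} (hn : n ∈ N) :
    φ (condExp N φ x * n) = φ (x * n) := by
  rw [hφ.map_mul_comm, trace_mul_condExp N φ x hn, hφ.map_mul_comm]

theorem exists_sqrt {B : Type u} [CStarAlgebra B] {ι : Type} [Fintype ι] (a : ι → B) :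
    ∃ c : B, star c = c ∧ c * c = ∑ i, a i * star (a i) := by
  let _ : PartialOrder B := CStarAlgebra.spectralOrder B
  let _ : StarOrderedRing B := CStarAlgebra.spectralOrderedRing B
  have h : 0 ≤ ∑ i, a i * star (a i) := Finset.sum_nonneg fun i _ => mul_star_self_nonneg _
  exact ⟨CFC.sqrt (∑ i, a i * star (a i)), (IsSelfAdjoint.of_nonneg (CFC.sqrt_nonneg _)).star_eq,
    CFC.sqrt_mul_sqrt_self _ h⟩

/-- There are finitely many `b i` in `A` such that `∑ b i * e * (b i)⋆ = 1`. -/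
theorem exists_frame : ∃ (n : ℕ) (b : Fin n → A),
    ∑ i, incl N φ (b i) * proj N φ * star (incl N φ (b i)) = 1 := by
  let x := Module.finBasis ℂ A
  have hterm : ∀ y : A, incl N φ y * proj N φ * star (incl N φ y) =
      (incl N φ y * proj N φ) * star (incl N φ y * proj N φ) := fun y => by
    rw [star_mul, star_proj, mul_assoc _ (proj N φ) (proj N φ * _), ← mul_assoc (proj N φ),
      proj_mul_self, mul_assoc]
  obtain ⟨c, hc, hcS⟩ := exists_sqrt fun i => incl N φ (x i) * proj N φ
  set S : basic N φ := ∑ i, (incl N φ (x i) * proj N φ) * star (incl N φ (x i) * proj N φ) with hS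
  have hSact : ∀ y, act N φ S y = ∑ i, x i * condExp N φ (star (x i) * y) := fun y => by
    rw [hS]
    simp only [← hterm, map_sum, LinearMap.sum_apply, act_mul, ← map_star, act_incl, act_proj]
  have hker : ∀ y, act N φ S y = 0 → y = 0 := by
    intro y hy
    have h1 : ∀ i, φ (star (condExp N φ (star (x i) * y)) * condExp N φ (star (x i) * y)) =
        φ (star y * (x i * condExp N φ (star (x i) * y))) := fun i => by
      rw [← condExp_star, trace_condExp_mul N φ _ (condExp_mem N φ _), star_mul, star_star,
        mul_assoc]
    have h2 : ∑ i, φ (star (condExp N φ (star (x i) * y)) * condExp N φ (star (x i) * y)) = 0 := by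
      rw [Finset.sum_congr rfl fun i _ => h1 i, ← map_sum, ← Finset.mul_sum, ← hSact, hy,
        mul_zero, map_zero]
    have h3 : ∀ i, condExp N φ (star (x i) * y) = 0 := fun i => by
      have := (Finset.sum_eq_zero_iff_of_nonneg fun i _ =>
        IsFaithfulTrace.nonneg φ (condExp N φ (star (x i) * y))).mp h2 i (Finset.mem_univ i)
      by_contra hne
      exact (hφ.map_star_mul_self_pos _ hne).ne' this
    have h4 : ∀ i, φ (star (x i) * y) = 0 := fun i => by
      rw [← trace_condExp N φ, h3, map_zero]
    by_contra hne
    refine (hφ.map_star_mul_self_pos _ hne).ne' ?_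
    have h5 : star y * y = ∑ i, star (x.repr y i) • (star (x i) * y) := by
      conv_lhs => rw [← x.sum_repr y]
      rw [star_sum, x.sum_repr, Finset.sum_mul]
      simp
    rw [h5, map_sum]
    exact Finset.sum_eq_zero fun i _ => by rw [map_smul, h4, smul_zero]
  have hinj : Function.Injective (LinearMap.mulLeft ℂ c) := by
    refine (injective_iff_map_eq_zero _).mpr fun T hT => act_ext N φ fun y => ?_
    rw [map_zero, LinearMap.zero_apply]
    refine hker _ ?_
    rw [← act_mul, ← hcS, mul_assoc, show c * T = 0 from hT, mul_zero, map_zero,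
      LinearMap.zero_apply]
  obtain ⟨d, hd⟩ := (LinearMap.injective_iff_surjective.mp hinj) 1
  have hd : c * d = 1 := hd
  have hd' : star d * c = 1 := by
    have := congrArg star hd
    rwa [star_mul, hc, star_one] at this
  refine ⟨_, fun i => act N φ (star d) (x i), ?_⟩
  have : ∀ i, incl N φ (act N φ (star d) (x i)) * proj N φ *
      star (incl N φ (act N φ (star d) (x i))) =
      star d * ((incl N φ (x i) * proj N φ) * star (incl N φ (x i) * proj N φ)) * d := fun i => by
    rw [hterm, ← mul_incl_proj, star_mul, star_mul, star_star, star_mul]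
    simp only [mul_assoc]
  rw [Finset.sum_congr rfl fun i _ => this i, ← Finset.sum_mul, ← Finset.mul_sum, ← hS, ← hcS,
    ← mul_assoc, hd', one_mul, hd]

/-- The conditions defining the Markov extension of a trace to the basic construction. -/
structure IsMarkovExtension (τ : ℝ) (Φ : basic N φ →ₗ[ℂ] ℂ) : Prop where
  faithful : IsFaithfulTrace Φ
  map_incl : ∀ x : A, Φ (incl N φ x) = φ x
  map_incl_mul_proj : ∀ x : A, Φ (incl N φ x * proj N φ) = τ * φ x

/-- `φ` is a Markov trace of modulus `τ` for the inclusion `N ⊆ A`: it extends to a trace on the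
basic construction `{A, e}''` such that `φ (x e) = τ φ (x)` for all `x` in `A`. -/
def IsMarkovTrace (τ : ℝ) : Prop :=
  ∃ Φ : basic N φ →ₗ[ℂ] ℂ, IsMarkovExtension N φ τ Φ

section Frame

variable {n : ℕ} {b : Fin n → A}

theorem frame_apply (hb : ∑ i, incl N φ (b i) * proj N φ * star (incl N φ (b i)) = 1) (x : A) :
    ∑ i, b i * condExp N φ (star (b i) * x) = x := by
  have := congrArg (fun T => act N φ T x) hb
  simp only [map_sum, LinearMap.sum_apply, act_mul, ← map_star, act_incl, act_proj] at this
  rw [this]; rw [← map_one (incl N φ), act_incl, one_mul]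

theorem frame_apply' (hb : ∑ i, incl N φ (b i) * proj N φ * star (incl N φ (b i)) = 1) (x : A) :
    ∑ i, condExp N φ (x * b i) * star (b i) = x := by
  have := congrArg star (frame_apply N φ hb (star x))
  simpa [star_sum, ← condExp_star] using this

theorem frame_expand (hb : ∑ i, incl N φ (b i) * proj N φ * star (incl N φ (b i)) = 1)
    (T : basic N φ) :
    T = ∑ i, incl N φ (act N φ T (b i)) * proj N φ * incl N φ (star (b i)) := by
  conv_lhs => rw [← mul_one T, ← hb, Finset.mul_sum]
  refine Finset.sum_congr rfl fun i _ => ?_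
  rw [← mul_incl_proj, map_star]
  simp only [mul_assoc]

/-- The functional `T ↦ ∑ φ ((b i)⋆ T(b i))` on the basic construction. -/
noncomputable def frameTrace (b : Fin n → A) : basic N φ →ₗ[ℂ] ℂ :=
  ∑ i, φ ∘ₗ LinearMap.mulLeft ℂ (star (b i)) ∘ₗ (act N φ).flip (b i)

theorem frameTrace_apply (T : basic N φ) :
    frameTrace N φ b T = ∑ i, φ (star (b i) * act N φ T (b i)) := by
  simp [frameTrace]

theorem frameTrace_mul (hb : ∑ i, incl N φ (b i) * proj N φ * star (incl N φ (b i)) = 1)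
    (x y : A) : frameTrace N φ b (incl N φ x * proj N φ * incl N φ y) = φ (y * x) := by
  have h : ∀ i, φ (star (b i) * (x * condExp N φ (y * b i))) =
      φ (condExp N φ (y * b i) * star (b i) * x) := fun i => by
    rw [← mul_assoc, hφ.map_mul_comm, mul_assoc]
  simp only [frameTrace_apply, act_mul, act_incl, act_proj, h]
  rw [← map_sum, ← Finset.sum_mul, frame_apply' N φ hb]

theorem frameTrace_comm (hb : ∑ i, incl N φ (b i) * proj N φ * star (incl N φ (b i)) = 1)
    (S T : basic N φ) : frameTrace N φ b (S * T) = frameTrace N φ b (T * S) := by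
  have hmul : ∀ x y x' y' : A, incl N φ x * proj N φ * incl N φ y *
      (incl N φ x' * proj N φ * incl N φ y') =
      incl N φ (x * condExp N φ (y * x')) * proj N φ * incl N φ y' := by
    intro x y x' y'
    have := congrArg (fun Z => incl N φ x * Z * incl N φ y') (proj_incl_proj N φ (y * x'))
    simpa only [map_mul, mul_assoc] using this
  have key : ∀ x y x' y' : A,
      frameTrace N φ b (incl N φ x * proj N φ * incl N φ y *
        (incl N φ x' * proj N φ * incl N φ y')) =
      frameTrace N φ b (incl N φ x' * proj N φ * incl N φ y' *
        (incl N φ x * proj N φ * incl N φ y)) := by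
    intro x y x' y'
    rw [hmul, hmul, frameTrace_mul N φ hb, frameTrace_mul N φ hb, ← mul_assoc, ← mul_assoc,
      ← trace_condExp_mul N φ (y' * x) (condExp_mem N φ _),
      trace_mul_condExp N φ _ (condExp_mem N φ _), hφ.map_mul_comm]
  rw [frame_expand N φ hb S, frame_expand N φ hb T]
  simp only [Finset.sum_mul, Finset.mul_sum, map_sum]
  rw [Finset.sum_comm]
  exact Finset.sum_congr rfl fun i _ => Finset.sum_congr rfl fun j _ => key _ _ _ _

theorem frameTrace_pos (hb : ∑ i, incl N φ (b i) * proj N φ * star (incl N φ (b i)) = 1)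
    (T : basic N φ) (hT : T ≠ 0) : 0 < frameTrace N φ b (star T * T) := by
  have h1 : star T * T = ∑ i, incl N φ (act N φ (star T) (b i)) * proj N φ *
      incl N φ (star (act N φ (star T) (b i))) := by
    conv_lhs => rw [← mul_one (star T), ← hb, Finset.mul_sum, Finset.sum_mul]
    refine Finset.sum_congr rfl fun i _ => ?_
    have h3 := mul_incl_proj N φ (star T) (b i)
    have h4 := congrArg star h3
    simp only [star_mul, star_star, star_proj] at h4
    rw [map_star (incl N φ)]
    calc star T * (incl N φ (b i) * proj N φ * star (incl N φ (b i))) * T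
        = (star T * incl N φ (b i) * proj N φ) * (proj N φ * (star (incl N φ (b i)) * T)) := by
          rw [mul_assoc (star T * _), ← mul_assoc (proj N φ) (proj N φ), proj_mul_self]
          simp only [mul_assoc]
      _ = _ := by
          rw [h3, h4, mul_assoc, ← mul_assoc (proj N φ) (proj N φ), proj_mul_self, mul_assoc]
  rw [h1, map_sum]
  simp only [frameTrace_mul N φ hb]
  refine Finset.sum_pos' (fun i _ => IsFaithfulTrace.nonneg φ _) ?_
  by_contra hne
  push Not at hne
  have h0 : ∀ i, act N φ (star T) (b i) = 0 := fun i => by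
    by_contra hi
    exact hne i (Finset.mem_univ i) (hφ.map_star_mul_self_pos _ hi)
  apply hT
  rw [← star_star T, frame_expand N φ hb (star T)]
  simp [h0]

/-- The Markov extension of a trace is unique. -/
theorem IsMarkovExtension.unique {τ : ℝ} {Φ Ψ : basic N φ →ₗ[ℂ] ℂ}
    (hΦ : IsMarkovExtension N φ τ Φ) (hΨ : IsMarkovExtension N φ τ Ψ) : Φ = Ψ := by
  obtain ⟨n, b, hb⟩ := exists_frame N φ
  have key : ∀ {Θ : basic N φ →ₗ[ℂ] ℂ}, IsMarkovExtension N φ τ Θ → ∀ x y : A,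
      Θ (incl N φ x * proj N φ * incl N φ y) = τ * φ (y * x) := fun h x y => by
    rw [h.faithful.map_mul_comm, ← mul_assoc, ← map_mul, h.map_incl_mul_proj]
  ext T
  rw [frame_expand N φ hb T, map_sum, map_sum]
  exact Finset.sum_congr rfl fun i _ => by rw [key hΦ, key hΨ]

/-- A criterion for Markov traces in terms of a frame. -/
theorem isMarkovTrace_of_frame {τ : ℝ} (hτ : 0 < τ)
    (hb : ∀ x : A, ∑ i, b i * condExp N φ (star (b i) * x) = x)
    (hsum : ∑ i, b i * star (b i) = (τ : ℂ)⁻¹ • 1) : IsMarkovTrace N φ τ := by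
  have hτ' : (τ : ℂ) ≠ 0 := by exact_mod_cast hτ.ne'
  have hb' : ∑ i, incl N φ (b i) * proj N φ * star (incl N φ (b i)) = 1 := by
    refine act_ext N φ fun x => ?_
    rw [← map_one (incl N φ), act_incl, one_mul]
    simp only [map_sum, LinearMap.sum_apply, act_mul, ← map_star, act_incl, act_proj, hb]
  have hext : ∀ T, ((τ : ℂ) • frameTrace N φ b) (incl N φ T) = φ T := by
    intro T
    have h1 : ∀ i, φ (star (b i) * (T * b i)) = φ (T * (b i * star (b i))) := fun i => by
      rw [hφ.map_mul_comm, mul_assoc]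
    simp only [LinearMap.smul_apply, frameTrace_apply, act_incl, h1]
    rw [← map_sum, ← Finset.mul_sum, hsum, mul_smul_comm, mul_one, map_smul, smul_smul,
      mul_inv_cancel₀ hτ', one_smul]
  refine ⟨(τ : ℂ) • frameTrace N φ b, ⟨?_, ?_, ?_⟩, hext, ?_⟩
  · rw [← map_one (incl N φ), hext, hφ.map_one]
  · intro S T
    rw [LinearMap.smul_apply, LinearMap.smul_apply, frameTrace_comm _ _ hb']
  · intro T hT
    rw [LinearMap.smul_apply, smul_eq_mul]
    exact mul_pos (by exact_mod_cast hτ) (frameTrace_pos _ _ hb' T hT)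
  · intro T
    have := frameTrace_mul N φ hb' T 1
    rw [map_one, mul_one, one_mul] at this
    rw [LinearMap.smul_apply, this, smul_eq_mul]

end Frame

variable {N φ}

theorem IsMarkovExtension.pos {τ : ℝ} {Φ : basic N φ →ₗ[ℂ] ℂ} (h : IsMarkovExtension N φ τ Φ) :
    0 < τ := by
  have h0 : proj N φ ≠ 0 := by
    intro h0
    have := act_proj N φ 1
    rw [h0, map_zero, LinearMap.zero_apply, condExp_of_mem N φ (one_mem N)] at this
    have h1 := hφ.map_one
    rw [← this, map_zero] at h1
    exact zero_ne_one h1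
  have h1 := h.faithful.map_star_mul_self_pos _ h0
  have h2 := h.map_incl_mul_proj 1
  rw [star_proj, proj_mul_self] at h1
  rw [map_one, one_mul, hφ.map_one, mul_one] at h2
  rw [h2] at h1
  exact_mod_cast h1

theorem IsMarkovExtension.condExp_eq {τ : ℝ} {Φ : basic N φ →ₗ[ℂ] ℂ} [hΦ : IsFaithfulTrace Φ]
    (h : IsMarkovExtension N φ τ Φ) (x y : A) :
    condExp (incl N φ).range Φ (incl N φ x * proj N φ * incl N φ y) =
      (τ : ℂ) • incl N φ (x * y) := by
  refine condExp_unique _ _ (SMulMemClass.smul_mem _ ⟨x * y, rfl⟩) ?_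
  rintro _ ⟨m, rfl⟩
  change Φ (incl N φ m * _) = Φ (incl N φ m * _)
  have h1 : incl N φ m * ((τ : ℂ) • incl N φ (x * y)) = (τ : ℂ) • incl N φ (m * (x * y)) := by
    rw [mul_smul_comm, map_mul (incl N φ) m]
  have h2 : Φ (incl N φ m * (incl N φ x * proj N φ * incl N φ y)) =
      Φ (incl N φ (y * (m * x)) * proj N φ) := by
    rw [← mul_assoc, hΦ.map_mul_comm, map_mul (incl N φ), map_mul (incl N φ)]
    simp only [mul_assoc]
  rw [h1, h2, map_smul, h.map_incl, h.map_incl_mul_proj, ← mul_assoc m, hφ.map_mul_comm y, smul_eq_mul]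

/-- The extension of a Markov trace to the basic construction is a Markov trace. -/
theorem IsMarkovExtension.isMarkovTrace {τ : ℝ} {Φ : basic N φ →ₗ[ℂ] ℂ} [hΦ : IsFaithfulTrace Φ]
    (h : IsMarkovExtension N φ τ Φ) : IsMarkovTrace (incl N φ).range Φ τ := by
  obtain ⟨n, b, hb⟩ := exists_frame N φ
  have hτ := h.pos
  have hτ' : (τ : ℂ) ≠ 0 := by exact_mod_cast hτ.ne'
  obtain ⟨s, hs1, hs2⟩ : ∃ s : ℂ, star s = s ∧ s * s = (τ : ℂ)⁻¹ := by
    refine ⟨((Real.sqrt τ)⁻¹ : ℝ), Complex.conj_ofReal _, ?_⟩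
    rw [← Complex.ofReal_mul, ← mul_inv, Real.mul_self_sqrt hτ.le, Complex.ofReal_inv]
  have hstar : ∀ i, star (s • (incl N φ (b i) * proj N φ)) =
      s • (proj N φ * incl N φ (star (b i))) := fun i => by
    rw [star_smul, hs1, star_mul, star_proj, map_star]
  refine isMarkovTrace_of_frame (b := fun i => s • (incl N φ (b i) * proj N φ)) _ _ hτ ?_ ?_
  · intro T
    have key : ∀ x y : A, ∀ i, s • (incl N φ (b i) * proj N φ) * condExp (incl N φ).range Φ
        (star (s • (incl N φ (b i) * proj N φ)) * (incl N φ x * proj N φ * incl N φ y)) =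
        incl N φ (b i * condExp N φ (star (b i) * x)) * (proj N φ * incl N φ y) := by
      intro x y i
      have h2 : star (s • (incl N φ (b i) * proj N φ)) * (incl N φ x * proj N φ * incl N φ y) =
          s • (incl N φ (condExp N φ (star (b i) * x)) * proj N φ * incl N φ y) := by
        rw [hstar, ← proj_incl_proj, map_mul, smul_mul_assoc]
        simp only [mul_assoc]
      have h3 : s * s * (τ : ℂ) = 1 := by rw [hs2, inv_mul_cancel₀ hτ']
      rw [h2, map_smul, h.condExp_eq, smul_mul_assoc, mul_smul_comm, mul_smul_comm, smul_smul,
        smul_smul, h3, one_smul, map_mul (incl N φ) (condExp N φ _), map_mul (incl N φ) (b i)]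
      calc incl N φ (b i) * proj N φ * (incl N φ (condExp N φ (star (b i) * x)) * incl N φ y)
          = incl N φ (b i) * (proj N φ * incl N φ (condExp N φ (star (b i) * x))) * incl N φ y := by
            simp only [mul_assoc]
        _ = _ := by
            rw [← incl_proj_comm N φ (condExp_mem N φ _)]
            simp only [mul_assoc]
    have key2 : ∀ x y : A, ∑ i, s • (incl N φ (b i) * proj N φ) * condExp (incl N φ).range Φ
        (star (s • (incl N φ (b i) * proj N φ)) * (incl N φ x * proj N φ * incl N φ y)) =
        incl N φ x * proj N φ * incl N φ y := by
      intro x y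
      rw [Finset.sum_congr rfl fun i _ => key x y i, ← Finset.sum_mul, ← map_sum,
        frame_apply N φ hb, mul_assoc]
    rw [frame_expand N φ hb T]
    simp only [Finset.mul_sum, map_sum]
    rw [Finset.sum_comm]
    exact Finset.sum_congr rfl fun i _ => key2 _ _
  · rw [← hb, Finset.smul_sum]
    refine Finset.sum_congr rfl fun i _ => ?_
    rw [hstar, smul_mul_assoc, mul_smul_comm, smul_smul, hs2, map_star, mul_assoc,
      ← mul_assoc (proj N φ) (proj N φ), proj_mul_self, mul_assoc]

end Facts

end BasicConstruction

section GNS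

open UniformSpace

variable {A : Type u} [Ring A] [StarRing A] [Algebra ℂ A] [StarModule ℂ A]

/-- Left multiplications are bounded for the `L²`-norm of the trace `φ`. -/
class IsBoundedTrace (φ : A →ₗ[ℂ] ℂ) : Prop where
  bound : ∀ x : A, ∃ C : ℝ, ∀ y : A,
    (φ (star (x * y) * (x * y))).re ≤ C * (φ (star y * y)).re

variable (φ : A →ₗ[ℂ] ℂ) [hφ : IsFaithfulTrace φ]

theorem norm_sq_toL2 (x : A) : ‖toL2 φ x‖ ^ 2 = (φ (star x * x)).re := by
  rw [← inner_toL2, ← inner_self_eq_norm_sq (𝕜 := ℂ)]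
  rfl

/-- The Hilbert space of the GNS construction for `φ`. -/
abbrev GNSSpace : Type u := Completion (L2 φ)

variable [hb : IsBoundedTrace φ]

/-- Left multiplication as a bounded operator. -/
noncomputable def preLmul (x : A) : L2 φ →L[ℂ] L2 φ :=
  LinearMap.mkContinuousOfExistsBound
    ((toL2 φ).toLinearMap ∘ₗ LinearMap.mulLeft ℂ x ∘ₗ (toL2 φ).symm.toLinearMap) <| by
    obtain ⟨C, hC⟩ := hb.bound x
    refine ⟨Real.sqrt (max C 0), fun y => ?_⟩
    obtain ⟨y, rfl⟩ := (toL2 φ).surjective y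
    have h1 : ‖toL2 φ (x * y)‖ ^ 2 ≤ max C 0 * ‖toL2 φ y‖ ^ 2 := by
      have h0 := norm_sq_toL2 φ y
      rw [norm_sq_toL2, h0]
      exact (hC y).trans (mul_le_mul_of_nonneg_right (le_max_left _ _) (h0 ▸ sq_nonneg _))
    have h2 : ‖toL2 φ (x * y)‖ ≤ Real.sqrt (max C 0) * ‖toL2 φ y‖ := by
      refine abs_le_of_sq_le_sq' ?_ (by positivity) |>.2
      rw [mul_pow, Real.sq_sqrt (le_max_right _ _)]
      exact h1
    simpa using h2

theorem preLmul_toL2 (x y : A) : preLmul φ x (toL2 φ y) = toL2 φ (x * y) := by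
  simp [preLmul]

/-- The GNS representation: the action of `A` by left multiplication on the completion of
`L²(A, φ)`. -/
noncomputable def gnsRep : A →⋆ₐ[ℂ] (GNSSpace φ →L[ℂ] GNSSpace φ) where
  toFun x := (preLmul φ x).completion
  map_one' := by
    ext v
    induction v using Completion.induction_on with
    | hp => apply isClosed_eq <;> fun_prop
    | ih v =>
      obtain ⟨v, rfl⟩ := (toL2 φ).surjective v
      simp [preLmul_toL2]
  map_mul' x y := by
    ext v
    induction v using Completion.induction_on with
    | hp => apply isClosed_eq <;> fun_prop
    | ih v =>
      obtain ⟨v, rfl⟩ := (toL2 φ).surjective v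
      simp [preLmul_toL2, mul_assoc]
  map_zero' := by
    ext v
    induction v using Completion.induction_on with
    | hp => apply isClosed_eq <;> fun_prop
    | ih v =>
      obtain ⟨v, rfl⟩ := (toL2 φ).surjective v
      simp [preLmul_toL2]
  map_add' x y := by
    ext v
    induction v using Completion.induction_on with
    | hp => apply isClosed_eq <;> fun_prop
    | ih v =>
      obtain ⟨v, rfl⟩ := (toL2 φ).surjective v
      simp [preLmul_toL2, add_mul, Completion.coe_add]
  commutes' c := by
    ext v
    induction v using Completion.induction_on with
    | hp => apply isClosed_eq <;> fun_prop
    | ih v =>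
      obtain ⟨v, rfl⟩ := (toL2 φ).surjective v
      simp [preLmul_toL2, Algebra.algebraMap_eq_smul_one]
  map_star' x := by
    rw [ContinuousLinearMap.star_eq_adjoint, ContinuousLinearMap.eq_adjoint_iff]
    intro v w
    induction v, w using Completion.induction_on₂ with
    | hp => apply isClosed_eq <;> fun_prop
    | ih v w =>
      obtain ⟨v, rfl⟩ := (toL2 φ).surjective v
      obtain ⟨w, rfl⟩ := (toL2 φ).surjective w
      simp [preLmul_toL2, inner_toL2, mul_assoc]

theorem gnsRep_coe (x y : A) :
    gnsRep φ x (toL2 φ y : L2 φ) = ((toL2 φ (x * y) : L2 φ) : GNSSpace φ) := by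
  simp [gnsRep, preLmul_toL2]

/-- The cyclic trace vector of the GNS construction. -/
noncomputable def gnsVector : GNSSpace φ := (toL2 φ 1 : L2 φ)

/-- The von Neumann algebra `A''` generated by `A` in the GNS representation of `φ`. -/
noncomputable def gnsClosure : VonNeumannAlgebra (GNSSpace φ) where
  toStarSubalgebra := StarSubalgebra.centralizer ℂ
    (StarSubalgebra.centralizer ℂ (Set.range (gnsRep φ)) : Set (GNSSpace φ →L[ℂ] GNSSpace φ))
  centralizer_centralizer' := by
    change Set.centralizer (Set.centralizer (StarSubalgebra.centralizer ℂ
      (StarSubalgebra.centralizer ℂ (Set.range (gnsRep φ)) :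
        Set (GNSSpace φ →L[ℂ] GNSSpace φ)) : Set (GNSSpace φ →L[ℂ] GNSSpace φ))) = _
    rw [StarSubalgebra.coe_centralizer, Set.centralizer_centralizer_centralizer]
    rfl

theorem gnsRep_mem (x : A) : gnsRep φ x ∈ (gnsClosure φ).toStarSubalgebra := by
  refine (StarSubalgebra.mem_centralizer_iff ℂ).mpr fun g hg => ?_
  have := (StarSubalgebra.mem_centralizer_iff ℂ).mp hg (gnsRep φ x) ⟨x, rfl⟩
  exact ⟨this.1.symm, by
    have h3 := congrArg star this.2
    simp only [star_mul, star_star] at h3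
    exact h3⟩

/-- The embedding of `A` into the von Neumann algebra that it generates. -/
noncomputable def gnsIncl : A →⋆ₐ[ℂ] (gnsClosure φ).toStarSubalgebra :=
  (gnsRep φ).codRestrict _ (gnsRep_mem φ)

/-- The trace on the von Neumann algebra generated by `A`: the vector state of the GNS vector. -/
noncomputable def gnsTrace : (gnsClosure φ).toStarSubalgebra →ₗ[ℂ] ℂ where
  toFun T := ⟪gnsVector φ, (T : GNSSpace φ →L[ℂ] GNSSpace φ) (gnsVector φ)⟫_ℂ
  map_add' S T := by simp [inner_add_right]
  map_smul' c T := by simp [inner_smul_right]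

theorem gnsTrace_gnsIncl (x : A) : gnsTrace φ (gnsIncl φ x) = φ x := by
  change ⟪gnsVector φ, gnsRep φ x (gnsVector φ)⟫_ℂ = φ x
  rw [gnsVector, gnsRep_coe, Completion.inner_coe, inner_toL2]
  simp

end GNS

section Tower

/-- A finite dimensional C⋆-algebra `alg` with a unital `⋆`-subalgebra `sub` and a Markov trace
`tr` of modulus `τ`. -/
structure MarkovInclusion (τ : ℝ) : Type (u + 1) where
  alg : Type u
  [cstar : CStarAlgebra alg]
  [findim : FiniteDimensional ℂ alg]
  sub : StarSubalgebra ℂ alg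
  tr : alg →ₗ[ℂ] ℂ
  [faithful : IsFaithfulTrace tr]
  markov : IsMarkovTrace sub tr τ

attribute [instance] MarkovInclusion.cstar MarkovInclusion.findim MarkovInclusion.faithful

variable {τ : ℝ}

/-- The next inclusion in the tower: for `N ⊆ A` with Markov trace, the inclusion of `A` into the
basic construction `{A, e}''`, with the (unique) Markov extension of the trace. -/
noncomputable def MarkovInclusion.next (S : MarkovInclusion.{u} τ) : MarkovInclusion.{u} τ where
  alg := basic S.sub S.tr
  sub := (incl S.sub S.tr).range
  tr := Classical.choose S.markov
  faithful := (Classical.choose_spec S.markov).faithful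
  markov := by
    have := (Classical.choose_spec S.markov).faithful
    exact (Classical.choose_spec S.markov).isMarkovTrace

namespace MarkovInclusion

variable {τ : ℝ} (S : MarkovInclusion.{u} τ)

/-- The iterated basic construction.  If `S` is `B₀ ⊆ B₁`, then `S.tower n` is the inclusion
`Bₙ ⊆ Bₙ₊₁`, with the trace of the tower on `Bₙ₊₁`. -/
noncomputable def tower : ℕ → MarkovInclusion.{u} τ
  | 0 => S
  | n + 1 => (tower n).next

/-- The inclusion `Bₙ₊₁ ⊆ Bₙ₊₂`. -/
noncomputable def towerIncl (n : ℕ) : (S.tower n).alg →⋆ₐ[ℂ] (S.tower (n + 1)).alg :=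
  incl (S.tower n).sub (S.tower n).tr

/-- The Jones projection for `Bₙ ⊆ Bₙ₊₁`, as an element of `Bₙ₊₂`. -/
noncomputable def towerProj (n : ℕ) : (S.tower (n + 1)).alg :=
  proj (S.tower n).sub (S.tower n).tr

theorem isMarkovExtension_tower (n : ℕ) :
    IsMarkovExtension (S.tower n).sub (S.tower n).tr τ (S.tower (n + 1)).tr :=
  Classical.choose_spec (S.tower n).markov

theorem tr_towerIncl (n : ℕ) (x : (S.tower n).alg) :
    (S.tower (n + 1)).tr (S.towerIncl n x) = (S.tower n).tr x :=
  (S.isMarkovExtension_tower n).map_incl x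

/-- The inclusion `Bₘ₊₁ ⊆ Bₙ₊₁` for `m ≤ n`. -/
noncomputable def transit {m n : ℕ} (h : m ≤ n) : (S.tower m).alg →⋆ₐ[ℂ] (S.tower n).alg :=
  Nat.leRec (motive := fun k _ => (S.tower m).alg →⋆ₐ[ℂ] (S.tower k).alg)
    (StarAlgHom.id ℂ _) (fun k _ f => (S.towerIncl k).comp f) h

theorem transit_self (m : ℕ) (x : (S.tower m).alg) : S.transit le_rfl x = x := by
  rw [transit, Nat.leRec_self]; rfl

theorem transit_succ {m n : ℕ} (h : m ≤ n) (x : (S.tower m).alg) :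
    S.transit (Nat.le_succ_of_le h) x = S.towerIncl n (S.transit h x) := by
  rw [transit, Nat.leRec_succ _ _ h]; rfl

theorem transit_transit {k m n : ℕ} (h : k ≤ m) (h' : m ≤ n) (x : (S.tower k).alg) :
    S.transit h' (S.transit h x) = S.transit (h.trans h') x := by
  induction n, h' using Nat.le_induction with
  | base => rw [transit_self]
  | succ n h' ih => rw [transit_succ _ h', ih, transit_succ _ (h.trans h')]

theorem tr_transit {m n : ℕ} (h : m ≤ n) (x : (S.tower m).alg) :
    (S.tower n).tr (S.transit h x) = (S.tower m).tr x := by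
  induction n, h using Nat.le_induction with
  | base => rw [transit_self]
  | succ n h ih => rw [transit_succ _ h, tr_towerIncl, ih]

instance : DirectedSystem (fun n => (S.tower n).alg) (fun _ _ h => ⇑(S.transit h)) where
  map_self _ x := S.transit_self _ x
  map_map _ _ _ h h' x := S.transit_transit h h' x

/-- The `⋆`-algebra `⋃ Bₙ`, the direct limit of the tower. -/
abbrev union : Type u := DirectLimit (fun n => (S.tower n).alg) (fun _ _ h => S.transit h)

noncomputable instance : StarRing S.union :=
  { (inferInstance : StarMul S.union), (inferInstance : StarAddMonoid S.union) with }

noncomputable instance : Algebra ℂ S.union := Algebra.ofModule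
  (fun c x y => smul_mul_assoc c x y) (fun c x y => mul_smul_comm c x y)

/-- The inclusion of `Bₙ₊₁` into `⋃ Bₙ`. -/
noncomputable def toUnion (n : ℕ) : (S.tower n).alg →⋆ₐ[ℂ] S.union where
  toFun x := ⟦⟨n, x⟩⟧
  map_one' := (DirectLimit.one_def _).symm
  map_mul' _ _ := (DirectLimit.mul_def _ _ _).symm
  map_zero' := (DirectLimit.zero_def _).symm
  map_add' _ _ := (DirectLimit.add_def _ _ _).symm
  commutes' c := by
    rw [Algebra.algebraMap_eq_smul_one, Algebra.algebraMap_eq_smul_one, DirectLimit.one_def n,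
      DirectLimit.smul_def]
  map_star' _ := (DirectLimit.star_def _ _).symm

theorem exists_toUnion (x : S.union) : ∃ n y, x = S.toUnion n y :=
  DirectLimit.exists_eq_mk _ x

theorem exists_toUnion₂ (x y : S.union) : ∃ n x' y', x = S.toUnion n x' ∧ y = S.toUnion n y' :=
  DirectLimit.exists_eq_mk₂ _ x y

theorem toUnion_transit {m n : ℕ} (h : m ≤ n) (x : (S.tower m).alg) :
    S.toUnion n (S.transit h x) = S.toUnion m x :=
  DirectLimit.mk_apply _ _ _ _

/-- The trace on `⋃ Bₙ`. -/
noncomputable def unionTr : S.union →ₗ[ℂ] ℂ where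
  toFun := DirectLimit.lift _ (fun n x => (S.tower n).tr x) fun _ _ h x => (S.tr_transit h x).symm
  map_add' x y := by
    obtain ⟨n, x, y, rfl, rfl⟩ := S.exists_toUnion₂ x y
    rw [← map_add]
    exact map_add (S.tower n).tr x y
  map_smul' c x := by
    obtain ⟨n, x, rfl⟩ := S.exists_toUnion x
    rw [← map_smul]
    exact map_smul (S.tower n).tr c x

theorem unionTr_toUnion (n : ℕ) (x : (S.tower n).alg) :
    S.unionTr (S.toUnion n x) = (S.tower n).tr x := rfl

instance : IsFaithfulTrace S.unionTr where
  map_one := by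
    rw [← map_one (S.toUnion 0), unionTr_toUnion, (S.tower 0).faithful.map_one]
  map_mul_comm x y := by
    obtain ⟨n, x, y, rfl, rfl⟩ := S.exists_toUnion₂ x y
    rw [← map_mul, ← map_mul, unionTr_toUnion, unionTr_toUnion, (S.tower n).faithful.map_mul_comm]
  map_star_mul_self_pos x hx := by
    obtain ⟨n, x, rfl⟩ := S.exists_toUnion x
    rw [← map_star, ← map_mul, unionTr_toUnion]
    refine (S.tower n).faithful.map_star_mul_self_pos x fun h => hx ?_
    rw [h, map_zero]

theorem trace_mul_le {B : Type u} [CStarAlgebra B] (φ : B →ₗ[ℂ] ℂ) [IsFaithfulTrace φ] (x y : B) :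
    (φ (star (x * y) * (x * y))).re ≤ ‖x‖ ^ 2 * (φ (star y * y)).re := by
  let _ : PartialOrder B := CStarAlgebra.spectralOrder B
  let _ : StarOrderedRing B := CStarAlgebra.spectralOrderedRing B
  have h := CStarAlgebra.star_mul_le_algebraMap_norm_sq (a := x)
  obtain ⟨z, hz⟩ := CStarAlgebra.nonneg_iff_eq_star_mul_self.mp (sub_nonneg.mpr h)
  have h1 := (Complex.le_def.mp (IsFaithfulTrace.nonneg φ (z * y))).1
  have h2 : star (z * y) * (z * y) =
      ((‖x‖ ^ 2 : ℝ) : ℂ) • (star y * y) - star (x * y) * (x * y) := by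
    have h3 : algebraMap ℝ B (‖x‖ ^ 2) = ((‖x‖ ^ 2 : ℝ) : ℂ) • (1 : B) := by
      rw [Algebra.algebraMap_eq_smul_one, Complex.coe_smul]
    rw [star_mul, mul_assoc, ← mul_assoc (star z), ← hz, h3, sub_mul, mul_sub, smul_mul_assoc,
      one_mul, mul_smul_comm, star_mul]
    simp only [mul_assoc]
  rw [h2, map_sub, map_smul, Complex.sub_re, smul_eq_mul, Complex.re_ofReal_mul] at h1
  simpa using h1

instance : IsBoundedTrace S.unionTr where
  bound x := by
    obtain ⟨m, x, rfl⟩ := S.exists_toUnion x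
    refine ⟨‖x‖ ^ 2, fun y => ?_⟩
    obtain ⟨n, y, rfl⟩ := S.exists_toUnion y
    rw [← S.toUnion_transit (le_max_left m n) x, ← S.toUnion_transit (le_max_right m n) y,
      ← map_mul, ← map_star, ← map_star, ← map_mul, ← map_mul, unionTr_toUnion, unionTr_toUnion]
    refine (trace_mul_le _ _ _).trans (mul_le_mul_of_nonneg_right ?_
      (Complex.le_def.mp (IsFaithfulTrace.nonneg _ _)).1)
    gcongr
    exact NonUnitalStarAlgHom.norm_apply_le _ x

/-- The von Neumann algebra `B_∞`: the closure of `⋃ Bₙ` in the GNS representation of its trace. -/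
noncomputable def limitVN : VonNeumannAlgebra (GNSSpace S.unionTr) := gnsClosure S.unionTr

/-- `B_∞` as a type. -/
abbrev BInf : Type u := S.limitVN.toStarSubalgebra

/-- The trace on `B_∞`. -/
noncomputable def trInf : S.BInf →ₗ[ℂ] ℂ := gnsTrace S.unionTr

/-- The inclusion of `Bₙ₊₁` into `B_∞`. -/
noncomputable def toBInf (n : ℕ) : (S.tower n).alg →⋆ₐ[ℂ] S.BInf :=
  (gnsIncl S.unionTr).comp (S.toUnion n)

/-- The `n`-th algebra `Bₙ` of the tower, as a subalgebra of `B_∞`. -/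
noncomputable def level : ℕ → StarSubalgebra ℂ S.BInf
  | 0 => S.sub.map (S.toBInf 0)
  | n + 1 => (S.toBInf n).range

/-- `S.jones n` is the Jones projection `eₙ₊₂` in `B_∞`: it implements the conditional expectation
of `Bₙ₊₁` onto `Bₙ`, and together with `Bₙ₊₁` it generates `Bₙ₊₂`. -/
noncomputable def jones (n : ℕ) : S.BInf := S.toBInf (n + 1) (S.towerProj n)

end MarkovInclusion

/-- An inclusion of algebras `N ⊆ A` is connected if the elements of `N` that commute with `A` are
the scalars. -/
def IsConnectedInclusion {A : Type u} [Ring A] [StarRing A] [Algebra ℂ A] [StarModule ℂ A]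
    (N : StarSubalgebra ℂ A) : Prop :=
  ∀ x ∈ N, (∀ y : A, x * y = y * x) → ∃ c : ℂ, x = algebraMap ℂ A c

end Tower

end JonesTower

/-! Existence. A trace-preserving automorphism of B₁ is isometric for the trace inner product, so it
is a unitary u of L²(B₁). Conjugation by u sends left multiplication by x to left multiplication by
a(x), and it fixes e₂, because a preserves both the trace and B₀ and therefore commutes with the
conditional expectation onto B₀. Hence Ad u preserves the generators of B₂, and with them the
bicommutant B₂ itself. It also preserves the extended trace: composing that trace with Ad u gives
another Markov extension of the trace on B₁, and such an extension is unique
(`IsMarkovExtension.unique`). The result is a trace-preserving automorphism of B₂ that leaves B₁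
invariant, so the construction iterates. The automorphisms of the levels are compatible, so they
glue on the union, and the same unitary argument in the GNS space carries the glued map to B_∞.

Uniqueness. By `frame_expand`, each basic construction is spanned by the products x e y with x, y in
the algebra below. By induction, the values on B₁ and on the Jones projections therefore determine
an automorphism on every level, hence on the union (`equiv_toBInf_ext`, `equiv_gnsIncl_ext`). No
continuity of α is assumed in passing to B_∞. Instead, an element T of B_∞ is determined by the
numbers tr(x T y) with x, y in the union, and preservation of the trace fixes these numbers for α(T)
(`gnsClosure_equiv_ext`). -/

namespace JonesTower

/-! ### Automorphisms, invariant subalgebras and commutants -/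

section Restriction

variable {E : Type u} [Ring E] [StarRing E] [Algebra ℂ E] [StarModule ℂ E]

/-- The restriction of a `⋆`-automorphism to an invariant `⋆`-subalgebra. -/
def restrictEquiv (f : E ≃⋆ₐ[ℂ] E) (M : StarSubalgebra ℂ E) (h : ∀ x, f x ∈ M ↔ x ∈ M) :
    M ≃⋆ₐ[ℂ] M where
  toFun x := ⟨f x, (h x).2 x.2⟩
  invFun x := ⟨f.symm x, (h _).1 (by rw [StarAlgEquiv.apply_symm_apply]; exact x.2)⟩
  left_inv x := Subtype.ext (f.symm_apply_apply x)
  right_inv x := Subtype.ext (f.apply_symm_apply x)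
  map_mul' x y := Subtype.ext (map_mul f _ _)
  map_add' x y := Subtype.ext (map_add f _ _)
  map_star' x := Subtype.ext (map_star f _)
  map_smul' c x := Subtype.ext (map_smul f c _)

/-- An automorphism transports commutation relations in both directions. Applied twice, this handles
bicommutants, which is how both the basic construction and the GNS closure are defined. -/
theorem apply_mem_centralizer_iff (f : E ≃⋆ₐ[ℂ] E) {s : Set E} (hs : ∀ x, f x ∈ s ↔ x ∈ s)
    (x : E) : f x ∈ StarSubalgebra.centralizer ℂ s ↔ x ∈ StarSubalgebra.centralizer ℂ s := by
  rw [StarSubalgebra.mem_centralizer_iff, StarSubalgebra.mem_centralizer_iff]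
  have key : ∀ g : E, (f g * f x = f x * f g ∧ star (f g) * f x = f x * star (f g)) ↔
      (g * x = x * g ∧ star g * x = x * star g) := fun g => by
    simp only [← map_star, ← map_mul, EquivLike.apply_eq_iff_eq]
  constructor
  · exact fun h g hg => (key g).1 (h (f g) ((hs g).2 hg))
  · intro h g hg
    obtain ⟨g, rfl⟩ := EquivLike.surjective f g
    exact (key g).2 (h g ((hs g).1 hg))

/-- A `⋆`-automorphism that preserves a finite dimensional `⋆`-subalgebra maps it onto itself. -/
theorem apply_mem_iff_of_finiteDimensional [FiniteDimensional ℂ E] (f : E ≃⋆ₐ[ℂ] E)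
    (M : StarSubalgebra ℂ E) (h : ∀ x ∈ M, f x ∈ M) (x : E) : f x ∈ M ↔ x ∈ M := by
  refine ⟨fun hx => ?_, h x⟩
  -- The restriction to `M` is an injective endomorphism of a finite-dimensional space, hence onto
  -- `M`. So `f x` is also the image of an element of `M`, which must be `x`.
  have hinj : Function.Injective
      ((f.toAlgEquiv.toLinearMap).restrict (p := M.toSubalgebra.toSubmodule)
        (q := M.toSubalgebra.toSubmodule) h) := fun y z hyz =>
    Subtype.ext (EquivLike.injective f (congrArg Subtype.val hyz))
  obtain ⟨y, hy⟩ := LinearMap.injective_iff_surjective.mp hinj ⟨f x, hx⟩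
  have : f y = f x := congrArg Subtype.val hy
  exact (EquivLike.injective f this) ▸ y.2

end Restriction

/-! ### Unitary implementation on L² -/

section L2Equiv

variable {A : Type u} [Ring A] [StarRing A] [Algebra ℂ A] [StarModule ℂ A]
  (φ : A →ₗ[ℂ] ℂ) [hφ : IsFaithfulTrace φ] (f : A ≃⋆ₐ[ℂ] A) (hf : ∀ x, φ (f x) = φ x)

/-- The unitary of `L²(A, φ)` given by a trace-preserving `⋆`-automorphism of `A`. -/
noncomputable def l2Equiv : L2 φ ≃ₗᵢ[ℂ] L2 φ :=
  LinearEquiv.isometryOfInner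
    ((toL2 φ).symm.trans (f.toAlgEquiv.toLinearEquiv.trans (toL2 φ))) fun x y => by
    obtain ⟨x, rfl⟩ := (toL2 φ).surjective x
    obtain ⟨y, rfl⟩ := (toL2 φ).surjective y
    change ⟪toL2 φ (f x), toL2 φ (f y)⟫_ℂ = _
    rw [inner_toL2, inner_toL2, ← map_star, ← map_mul, hf]

theorem l2Equiv_toL2 (x : A) : l2Equiv φ f hf (toL2 φ x) = toL2 φ (f x) := rfl

theorem l2Equiv_symm_toL2 (x : A) : (l2Equiv φ f hf).symm (toL2 φ x) = toL2 φ (f.symm x) := rfl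

end L2Equiv

/-! ### Extension to the basic construction -/

section BasicEquiv

variable {A : Type u} [Ring A] [StarRing A] [Algebra ℂ A] [StarModule ℂ A]
  [FiniteDimensional ℂ A] (N : StarSubalgebra ℂ A) (φ : A →ₗ[ℂ] ℂ) [hφ : IsFaithfulTrace φ]
  (f : A ≃⋆ₐ[ℂ] A) (hf : ∀ x, φ (f x) = φ x) (hN : ∀ x, f x ∈ N ↔ x ∈ N)

-- The conditional expectation is characterized by the trace and the subalgebra alone, and `f`
-- preserves both.
include hf hN in
theorem condExp_apply (x : A) : condExp N φ (f x) = f (condExp N φ x) := by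
  refine condExp_unique N φ ((hN _).2 (condExp_mem N φ x)) fun n hn => ?_
  -- Every test element of `N` is `f` of an element of `N`, so invariance of the trace removes `f`
  -- from both sides.
  obtain ⟨n, rfl⟩ := EquivLike.surjective f n
  rw [← map_mul, ← map_mul, hf, hf, trace_mul_condExp N φ x ((hN n).1 hn)]

theorem conj_lmul (x : A) : (l2Equiv φ f hf).conjStarAlgEquiv (lmul φ x) = lmul φ (f x) := by
  ext y
  obtain ⟨y, rfl⟩ := (toL2 φ).surjective y
  rw [LinearIsometryEquiv.conjStarAlgEquiv_apply_apply, l2Equiv_symm_toL2, lmul_toL2, lmul_toL2,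
    l2Equiv_toL2, map_mul, StarAlgEquiv.apply_symm_apply]

-- On vectors coming from `A` the Jones projection is the conditional expectation, so this is
-- `condExp_apply` read on L².
include hN in
theorem conj_jonesProj :
    (l2Equiv φ f hf).conjStarAlgEquiv (jonesProj N φ) = jonesProj N φ := by
  ext y
  obtain ⟨y, rfl⟩ := (toL2 φ).surjective y
  rw [LinearIsometryEquiv.conjStarAlgEquiv_apply_apply, l2Equiv_symm_toL2, jonesProj_toL2,
    jonesProj_toL2, l2Equiv_toL2, ← condExp_apply N φ f hf hN, StarAlgEquiv.apply_symm_apply]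

-- The generating set, left multiplications together with the Jones projection, is preserved in both
-- directions; hence so are its commutant and its bicommutant.
include hN in
theorem conj_mem_basic_iff (T : L2 φ →L[ℂ] L2 φ) :
    (l2Equiv φ f hf).conjStarAlgEquiv T ∈ basic N φ ↔ T ∈ basic N φ := by
  refine apply_mem_centralizer_iff _ (apply_mem_centralizer_iff _ fun S => ?_) T
  constructor
  · rintro (⟨x, hx⟩ | hS)
    · refine Or.inl ⟨f.symm x, EquivLike.injective (l2Equiv φ f hf).conjStarAlgEquiv ?_⟩
      rw [conj_lmul, StarAlgEquiv.apply_symm_apply, hx]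
    · exact Or.inr (EquivLike.injective (l2Equiv φ f hf).conjStarAlgEquiv
        (hS.trans (conj_jonesProj N φ f hf hN).symm))
  · rintro (⟨x, rfl⟩ | rfl)
    · exact Or.inl ⟨f x, (conj_lmul φ f hf x).symm⟩
    · exact Or.inr (conj_jonesProj N φ f hf hN)

/-- The extension of a trace-preserving `⋆`-automorphism of `N ⊆ A` to the basic construction. -/
noncomputable def basicEquiv : basic N φ ≃⋆ₐ[ℂ] basic N φ :=
  restrictEquiv (l2Equiv φ f hf).conjStarAlgEquiv (basic N φ) (conj_mem_basic_iff N φ f hf hN)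

theorem basicEquiv_incl (x : A) : basicEquiv N φ f hf hN (incl N φ x) = incl N φ (f x) :=
  Subtype.ext (conj_lmul φ f hf x)

theorem basicEquiv_proj : basicEquiv N φ f hf hN (proj N φ) = proj N φ :=
  Subtype.ext (conj_jonesProj N φ f hf hN)

/-- Invariance comes from uniqueness: the pullback of `Φ` along the extended automorphism satisfies
the same defining conditions as `Φ`. This is what allows the extension to be iterated. -/
theorem IsMarkovExtension.basicEquiv_apply {τ : ℝ} {Φ : basic N φ →ₗ[ℂ] ℂ}
    (h : IsMarkovExtension N φ τ Φ) (T : basic N φ) : Φ (basicEquiv N φ f hf hN T) = Φ T := by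
  have hfaith := h.faithful
  set β := basicEquiv N φ f hf hN with hβ
  have h' : IsMarkovExtension N φ τ (Φ ∘ₗ β.toAlgEquiv.toLinearMap) := by
    refine ⟨⟨?_, fun x y => ?_, fun x hx => ?_⟩, fun x => ?_, fun x => ?_⟩
    · change Φ (β 1) = 1
      rw [map_one, hfaith.map_one]
    · change Φ (β (x * y)) = Φ (β (y * x))
      rw [map_mul β, map_mul β, hfaith.map_mul_comm]
    · change 0 < Φ (β (star x * x))
      rw [map_mul β, map_star β]
      exact hfaith.map_star_mul_self_pos _ fun h0 =>
        hx (EquivLike.injective β (h0.trans (map_zero β).symm))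
    · change Φ (β (incl N φ x)) = _
      rw [hβ, basicEquiv_incl, h.map_incl, hf]
    · change Φ (β (incl N φ x * proj N φ)) = _
      rw [map_mul β, hβ, basicEquiv_incl, basicEquiv_proj, h.map_incl_mul_proj, hf]
  exact LinearMap.congr_fun (IsMarkovExtension.unique N φ h' h) T

/-- Automorphisms of an algebra that agree on the images of `A` and of the Jones projection agree on
the image of the basic construction. -/
theorem basic_equiv_ext {C : Type*} [Ring C] [StarRing C] [Algebra ℂ C] (ι : basic N φ →⋆ₐ[ℂ] C)
    {α β : C ≃⋆ₐ[ℂ] C} (hincl : ∀ x, α (ι (incl N φ x)) = β (ι (incl N φ x)))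
    (hproj : α (ι (proj N φ)) = β (ι (proj N φ))) (T : basic N φ) : α (ι T) = β (ι T) := by
  -- A frame writes `T` as a finite sum of terms x e y with x, y in `A`, so its image is determined
  -- by those of `A` and e.
  obtain ⟨n, b, hb⟩ := exists_frame N φ
  rw [frame_expand N φ hb T]
  simp only [map_sum, map_mul, hincl, hproj]

end BasicEquiv

/-! ### Extension to the von Neumann algebra, and rigidity there -/

section GNSEquiv

open UniformSpace

variable {A : Type u} [Ring A] [StarRing A] [Algebra ℂ A] [StarModule ℂ A]
  (φ : A →ₗ[ℂ] ℂ) [hφ : IsFaithfulTrace φ] [hb : IsBoundedTrace φ]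
  (f : A ≃⋆ₐ[ℂ] A) (hf : ∀ x, φ (f x) = φ x)

/-- The unitary of the GNS space given by a trace-preserving `⋆`-automorphism. -/
noncomputable def gnsUnitary : GNSSpace φ ≃ₗᵢ[ℂ] GNSSpace φ :=
  (l2Equiv φ f hf).toLinearEquiv.extendOfIsometry
    (Completion.toComplL (𝕜 := ℂ) (E := L2 φ)).toLinearMap
    (Completion.toComplL (𝕜 := ℂ) (E := L2 φ)).toLinearMap
    Completion.denseRange_coe Completion.denseRange_coe fun x => by simp

omit hb in
theorem gnsUnitary_coe (x : A) :
    gnsUnitary φ f hf ((toL2 φ x : L2 φ) : GNSSpace φ) = ((toL2 φ (f x) : L2 φ) : GNSSpace φ) :=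
  LinearEquiv.extendOfIsometry_eq (l2Equiv φ f hf).toLinearEquiv _ _ _ _ _ (toL2 φ x)

omit hb in
theorem gnsUnitary_symm_coe (x : A) :
    (gnsUnitary φ f hf).symm ((toL2 φ x : L2 φ) : GNSSpace φ) =
      ((toL2 φ (f.symm x) : L2 φ) : GNSSpace φ) := by
  rw [LinearIsometryEquiv.symm_apply_eq, gnsUnitary_coe, StarAlgEquiv.apply_symm_apply]

theorem conj_gnsRep (x : A) :
    (gnsUnitary φ f hf).conjStarAlgEquiv (gnsRep φ x) = gnsRep φ (f x) := by
  ext v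
  induction v using Completion.induction_on with
  | hp => apply isClosed_eq <;> fun_prop
  | ih v =>
    obtain ⟨v, rfl⟩ := (toL2 φ).surjective v
    rw [LinearIsometryEquiv.conjStarAlgEquiv_apply_apply, gnsUnitary_symm_coe, gnsRep_coe,
      gnsRep_coe, gnsUnitary_coe, map_mul, StarAlgEquiv.apply_symm_apply]

/-- The unitary normalizes the represented copy of `A`, hence also its bicommutant. -/
theorem conj_mem_gnsClosure_iff (T : GNSSpace φ →L[ℂ] GNSSpace φ) :
    (gnsUnitary φ f hf).conjStarAlgEquiv T ∈ (gnsClosure φ).toStarSubalgebra ↔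
      T ∈ (gnsClosure φ).toStarSubalgebra := by
  refine apply_mem_centralizer_iff _ (apply_mem_centralizer_iff _ fun S => ?_) T
  constructor
  · rintro ⟨x, hx⟩
    refine ⟨f.symm x, EquivLike.injective (gnsUnitary φ f hf).conjStarAlgEquiv ?_⟩
    rw [conj_gnsRep, StarAlgEquiv.apply_symm_apply, hx]
  · rintro ⟨x, rfl⟩
    exact ⟨f x, (conj_gnsRep φ f hf x).symm⟩

/-- The extension of a trace-preserving `⋆`-automorphism of `A` to the von Neumann algebra that `A`
generates in the GNS representation. -/
noncomputable def gnsEquiv :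
    (gnsClosure φ).toStarSubalgebra ≃⋆ₐ[ℂ] (gnsClosure φ).toStarSubalgebra :=
  restrictEquiv (gnsUnitary φ f hf).conjStarAlgEquiv _ (conj_mem_gnsClosure_iff φ f hf)

theorem gnsEquiv_gnsIncl (x : A) : gnsEquiv φ f hf (gnsIncl φ x) = gnsIncl φ (f x) :=
  Subtype.ext (conj_gnsRep φ f hf x)

/-- The trace is the vector state of the class of 1, and the unitary fixes that vector because `f 1
= 1`. -/
theorem gnsTrace_gnsEquiv (T : (gnsClosure φ).toStarSubalgebra) :
    gnsTrace φ (gnsEquiv φ f hf T) = gnsTrace φ T := by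
  have h : (gnsUnitary φ f hf).symm (gnsVector φ) = gnsVector φ := by
    rw [gnsVector, gnsUnitary_symm_coe, map_one]
  change ⟪gnsVector φ, gnsUnitary φ f hf
    ((T : GNSSpace φ →L[ℂ] GNSSpace φ) ((gnsUnitary φ f hf).symm (gnsVector φ)))⟫_ℂ =
      ⟪gnsVector φ, (T : GNSSpace φ →L[ℂ] GNSSpace φ) (gnsVector φ)⟫_ℂ
  rw [← LinearIsometryEquiv.inner_map_map (gnsUnitary φ f hf).symm, h,
    LinearIsometryEquiv.symm_apply_apply]

/-- Moving the left factor across as an adjoint exhibits the trace of a product as a matrix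
coefficient between vectors from `A`. These vectors are dense, so such traces see the whole
operator. -/
theorem gnsTrace_star_mul_mul (x y : A) (T : (gnsClosure φ).toStarSubalgebra) :
    gnsTrace φ (gnsIncl φ (star x) * T * gnsIncl φ y) =
      ⟪((toL2 φ x : L2 φ) : GNSSpace φ),
        (T : GNSSpace φ →L[ℂ] GNSSpace φ) ((toL2 φ y : L2 φ) : GNSSpace φ)⟫_ℂ := by
  change ⟪gnsVector φ, gnsRep φ (star x)
    ((T : GNSSpace φ →L[ℂ] GNSSpace φ) (gnsRep φ y (gnsVector φ)))⟫_ℂ = _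
  rw [map_star, ContinuousLinearMap.star_eq_adjoint, ContinuousLinearMap.adjoint_inner_right,
    gnsVector, gnsRep_coe, gnsRep_coe, mul_one, mul_one]

/-- An operator in the von Neumann algebra generated by `A` is determined by the trace of its
products with elements of `A`. -/
theorem gnsClosure_ext {S T : (gnsClosure φ).toStarSubalgebra}
    (h : ∀ x y, gnsTrace φ (gnsIncl φ x * S * gnsIncl φ y) =
      gnsTrace φ (gnsIncl φ x * T * gnsIncl φ y)) : S = T := by
  apply Subtype.ext
  ext v
  refine ext_inner_left ℂ fun w => ?_
  -- Matrix coefficients are continuous in both vectors, so vectors from `A` suffice.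
  induction w, v using Completion.induction_on₂ with
  | hp => apply isClosed_eq <;> fun_prop
  | ih w v =>
    obtain ⟨v, rfl⟩ := (toL2 φ).surjective v
    obtain ⟨w, rfl⟩ := (toL2 φ).surjective w
    rw [← gnsTrace_star_mul_mul, ← gnsTrace_star_mul_mul, h]

/-- Trace-preserving `⋆`-automorphisms of the von Neumann algebra generated by `A` that agree on
`A`, and map `A` onto itself, are equal. -/
theorem gnsClosure_equiv_ext {g : A → A} (hg : Function.Surjective g)
    {α β : (gnsClosure φ).toStarSubalgebra ≃⋆ₐ[ℂ] (gnsClosure φ).toStarSubalgebra}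
    (hα : ∀ T, gnsTrace φ (α T) = gnsTrace φ T) (hβ : ∀ T, gnsTrace φ (β T) = gnsTrace φ T)
    (hαg : ∀ x, α (gnsIncl φ x) = gnsIncl φ (g x))
    (hβg : ∀ x, β (gnsIncl φ x) = gnsIncl φ (g x)) : α = β := by
  refine StarAlgEquiv.ext fun T => gnsClosure_ext φ fun x y => ?_
  -- With test elements `g x` and `g y`, both sides are traces of images of the single element x T
  -- y, under `α` and under `β`; invariance of the trace makes them equal.
  obtain ⟨x, rfl⟩ := hg x
  obtain ⟨y, rfl⟩ := hg y
  trans gnsTrace φ (gnsIncl φ x * T * gnsIncl φ y)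
  · rw [← hα (gnsIncl φ x * T * gnsIncl φ y), map_mul α, map_mul α, hαg, hαg]
  · rw [← hβ (gnsIncl φ x * T * gnsIncl φ y), map_mul β, map_mul β, hβg, hβg]

end GNSEquiv

/-! ### Iteration along the tower and passage to the limit -/

namespace MarkovInclusion

variable {τ : ℝ}

/-- A trace-preserving `⋆`-automorphism of an inclusion of algebras. -/
structure Aut (S : MarkovInclusion.{u} τ) where
  equiv : S.alg ≃⋆ₐ[ℂ] S.alg
  tr_apply : ∀ x, S.tr (equiv x) = S.tr x
  mem_sub_iff : ∀ x, equiv x ∈ S.sub ↔ x ∈ S.sub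

/-- The extension of an automorphism of `N ⊆ A` to the inclusion of `A` into the basic
construction. -/
noncomputable def Aut.next {S : MarkovInclusion.{u} τ} (f : Aut S) : Aut S.next where
  equiv := basicEquiv S.sub S.tr f.equiv f.tr_apply f.mem_sub_iff
  tr_apply := IsMarkovExtension.basicEquiv_apply S.sub S.tr f.equiv f.tr_apply f.mem_sub_iff
    (Classical.choose_spec S.markov)
  mem_sub_iff x := by
    constructor
    · rintro ⟨y, hy⟩
      refine ⟨f.equiv.symm y,
        EquivLike.injective (basicEquiv S.sub S.tr f.equiv f.tr_apply f.mem_sub_iff) ?_⟩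
      refine (basicEquiv_incl _ _ _ _ _ _).trans ?_
      rw [StarAlgEquiv.apply_symm_apply]
      exact hy
    · rintro ⟨y, rfl⟩
      exact ⟨f.equiv y, (basicEquiv_incl _ _ _ _ _ _).symm⟩

variable {S : MarkovInclusion.{u} τ} (f : Aut S)

/-- The extension of an automorphism to the inclusions of the tower. -/
noncomputable def Aut.tower : ∀ n, Aut (S.tower n)
  | 0 => f
  | n + 1 => (Aut.tower n).next

theorem Aut.tower_towerIncl (n : ℕ) (x : (S.tower n).alg) :
    (f.tower (n + 1)).equiv (S.towerIncl n x) = S.towerIncl n ((f.tower n).equiv x) :=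
  basicEquiv_incl _ _ _ _ (f.tower n).mem_sub_iff _

theorem Aut.tower_towerProj (n : ℕ) :
    (f.tower (n + 1)).equiv (S.towerProj n) = S.towerProj n :=
  basicEquiv_proj _ _ _ _ (f.tower n).mem_sub_iff

theorem Aut.tower_transit {m n : ℕ} (h : m ≤ n) (x : (S.tower m).alg) :
    (f.tower n).equiv (S.transit h x) = S.transit h ((f.tower m).equiv x) := by
  induction n, h using Nat.le_induction with
  | base => rw [transit_self, transit_self]
  | succ n h ih => rw [transit_succ _ h, tower_towerIncl, ih, transit_succ _ h]

/-- Makes the inverses compatible with the tower as well, so that they descend to the direct limit.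
-/
theorem Aut.tower_symm_transit {m n : ℕ} (h : m ≤ n) (x : (S.tower m).alg) :
    (f.tower n).equiv.symm (S.transit h x) = S.transit h ((f.tower m).equiv.symm x) := by
  apply EquivLike.injective (f.tower n).equiv
  rw [tower_transit, StarAlgEquiv.apply_symm_apply, StarAlgEquiv.apply_symm_apply]

/-- The extension of an automorphism to the union of the tower. -/
noncomputable def Aut.union : S.union ≃⋆ₐ[ℂ] S.union where
  toFun := DirectLimit.lift _ (fun n x => S.toUnion n ((f.tower n).equiv x)) fun _ _ h x => by
    rw [tower_transit, toUnion_transit]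
  invFun := DirectLimit.lift _ (fun n x => S.toUnion n ((f.tower n).equiv.symm x))
    fun _ _ h x => by rw [tower_symm_transit, toUnion_transit]
  left_inv x := by
    obtain ⟨n, x, rfl⟩ := S.exists_toUnion x
    exact congrArg (S.toUnion n) ((f.tower n).equiv.symm_apply_apply x)
  right_inv x := by
    obtain ⟨n, x, rfl⟩ := S.exists_toUnion x
    exact congrArg (S.toUnion n) ((f.tower n).equiv.apply_symm_apply x)
  map_mul' x y := by
    obtain ⟨n, x, y, rfl, rfl⟩ := S.exists_toUnion₂ x y
    rw [← map_mul]
    change S.toUnion n ((f.tower n).equiv (x * y)) =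
      S.toUnion n ((f.tower n).equiv x) * S.toUnion n ((f.tower n).equiv y)
    rw [map_mul, map_mul]
  map_add' x y := by
    obtain ⟨n, x, y, rfl, rfl⟩ := S.exists_toUnion₂ x y
    rw [← map_add]
    change S.toUnion n ((f.tower n).equiv (x + y)) =
      S.toUnion n ((f.tower n).equiv x) + S.toUnion n ((f.tower n).equiv y)
    rw [map_add, map_add]
  map_star' x := by
    obtain ⟨n, x, rfl⟩ := S.exists_toUnion x
    rw [← map_star]
    change S.toUnion n ((f.tower n).equiv (star x)) = star (S.toUnion n ((f.tower n).equiv x))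
    rw [map_star, map_star]
  map_smul' c x := by
    obtain ⟨n, x, rfl⟩ := S.exists_toUnion x
    rw [← map_smul]
    change S.toUnion n ((f.tower n).equiv (c • x)) = c • S.toUnion n ((f.tower n).equiv x)
    rw [map_smul, map_smul]

theorem Aut.union_toUnion (n : ℕ) (x : (S.tower n).alg) :
    f.union (S.toUnion n x) = S.toUnion n ((f.tower n).equiv x) := rfl

theorem Aut.unionTr_union (x : S.union) : S.unionTr (f.union x) = S.unionTr x := by
  obtain ⟨n, x, rfl⟩ := S.exists_toUnion x
  rw [union_toUnion, unionTr_toUnion, unionTr_toUnion, (f.tower n).tr_apply]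

/-- The extension of an automorphism to `B_∞`. -/
noncomputable def Aut.bInf : S.BInf ≃⋆ₐ[ℂ] S.BInf := gnsEquiv S.unionTr f.union f.unionTr_union

theorem Aut.bInf_toBInf (n : ℕ) (x : (S.tower n).alg) :
    f.bInf (S.toBInf n x) = S.toBInf n ((f.tower n).equiv x) :=
  gnsEquiv_gnsIncl S.unionTr f.union f.unionTr_union (S.toUnion n x)

theorem Aut.trInf_bInf (T : S.BInf) : S.trInf (f.bInf T) = S.trInf T :=
  gnsTrace_gnsEquiv S.unionTr f.union f.unionTr_union T

theorem Aut.bInf_jones (n : ℕ) : f.bInf (S.jones n) = S.jones n := by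
  rw [jones, bInf_toBInf, tower_towerProj]

theorem Aut.bInf_image_level (n : ℕ) : f.bInf '' (S.level n) = S.level n := by
  -- Level 0 is the image of the subalgebra inside B₁, so it needs invariance of that subalgebra;
  -- level n + 1 is the full image of the n-th tower algebra, on which the automorphism is onto.
  cases n with
  | zero =>
    apply Set.Subset.antisymm
    · rintro _ ⟨_, ⟨x, hx, rfl⟩, rfl⟩
      exact ⟨f.equiv x, (f.mem_sub_iff x).2 hx, (f.bInf_toBInf 0 x).symm⟩
    · rintro _ ⟨x, hx, rfl⟩
      obtain ⟨x, rfl⟩ := EquivLike.surjective f.equiv x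
      exact ⟨S.toBInf 0 x, ⟨x, (f.mem_sub_iff x).1 hx, rfl⟩, f.bInf_toBInf 0 x⟩
  | succ n =>
    apply Set.Subset.antisymm
    · rintro _ ⟨_, ⟨x, rfl⟩, rfl⟩
      exact ⟨(f.tower n).equiv x, (f.bInf_toBInf n x).symm⟩
    · rintro _ ⟨x, rfl⟩
      obtain ⟨x, rfl⟩ := EquivLike.surjective (f.tower n).equiv x
      exact ⟨S.toBInf n x, ⟨x, rfl⟩, f.bInf_toBInf n x⟩

/-! ### Uniqueness -/

theorem toBInf_towerIncl (n : ℕ) (x : (S.tower n).alg) :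
    S.toBInf (n + 1) (S.towerIncl n x) = S.toBInf n x := by
  have h := S.toUnion_transit (Nat.le_succ n) x
  rw [transit_succ _ le_rfl, transit_self] at h
  exact congrArg (gnsIncl S.unionTr) h

/-- Automorphisms of `B_∞` that agree on `B₁` and on the Jones projections agree on every algebra of
the tower. -/
theorem equiv_toBInf_ext {α β : S.BInf ≃⋆ₐ[ℂ] S.BInf}
    (h0 : ∀ x, α (S.toBInf 0 x) = β (S.toBInf 0 x)) (hjones : ∀ n, α (S.jones n) = β (S.jones n))
    (n : ℕ) (x : (S.tower n).alg) : α (S.toBInf n x) = β (S.toBInf n x) := by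
  induction n with
  | zero => exact h0 x
  | succ n ih =>
    -- The next algebra is generated by the current one, where the induction hypothesis applies, and
    -- by the Jones projection, where agreement is assumed.
    refine basic_equiv_ext (S.tower n).sub (S.tower n).tr (S.toBInf (n + 1)) (fun x => ?_)
      (hjones n) x
    change α (S.toBInf (n + 1) (S.towerIncl n x)) = β (S.toBInf (n + 1) (S.towerIncl n x))
    rw [toBInf_towerIncl, ih]

/-- Automorphisms of `B_∞` that agree on every algebra of the tower agree on the union. -/
theorem equiv_gnsIncl_ext {α β : S.BInf ≃⋆ₐ[ℂ] S.BInf}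
    (h : ∀ n x, α (S.toBInf n x) = β (S.toBInf n x)) (x : S.union) :
    α (gnsIncl S.unionTr x) = β (gnsIncl S.unionTr x) :=
  Exists.elim (S.exists_toUnion x) fun n hn => Exists.elim hn fun y hy =>
    (congrArg (fun z => α (gnsIncl S.unionTr z)) hy).trans
      ((h n y).trans (congrArg (fun z => β (gnsIncl S.unionTr z)) hy.symm))

/-- Agreement spreads from B₁ and the Jones projections to the union, where both maps act as
`f.union`. Since `f.union` is onto, trace preservation then forces equality on B_∞. -/
theorem Aut.eq_bInf {α : S.BInf ≃⋆ₐ[ℂ] S.BInf} (htr : ∀ T, S.trInf (α T) = S.trInf T)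
    (hjones : ∀ n, α (S.jones n) = S.jones n)
    (h0 : ∀ x, α (S.toBInf 0 x) = S.toBInf 0 (f.equiv x)) : α = f.bInf :=
  gnsClosure_equiv_ext S.unionTr (EquivLike.surjective f.union) (α := α) (β := f.bInf) htr
    f.trInf_bInf
    (fun x => (equiv_gnsIncl_ext (equiv_toBInf_ext (fun x => (h0 x).trans (f.bInf_toBInf 0 x).symm)
      (fun n => (hjones n).trans (f.bInf_jones n).symm)) x).trans
      (gnsEquiv_gnsIncl S.unionTr f.union f.unionTr_union x))
    (gnsEquiv_gnsIncl S.unionTr f.union f.unionTr_union)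

end MarkovInclusion

end JonesTower

/-! ### The theorem -/

theorem theorem2p1 {B₁ : Type u} [CStarAlgebra B₁] [FiniteDimensional ℂ B₁]
    (B₀ : StarSubalgebra ℂ B₁) (hconn : JonesTower.IsConnectedInclusion B₀)
    (tr : B₁ →ₗ[ℂ] ℂ) [JonesTower.IsFaithfulTrace tr]
    (τ : ℝ) (htr : JonesTower.IsMarkovTrace B₀ tr τ)
    (a : B₁ ≃⋆ₐ[ℂ] B₁) (ha : ∀ x, tr (a x) = tr x) (haB : ∀ x ∈ B₀, a x ∈ B₀) :
    let S : JonesTower.MarkovInclusion τ := { alg := B₁, sub := B₀, tr := tr, markov := htr }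
    ∃! α : S.BInf ≃⋆ₐ[ℂ] S.BInf,
      (∀ x, S.trInf (α x) = S.trInf x) ∧
      (∀ n, α (S.jones n) = S.jones n) ∧
      (∀ n, α '' (S.level n) = S.level n) ∧
      (∀ x : B₁, α (S.toBInf 0 x) = S.toBInf 0 (a x)) := by
  intro S
  -- Only a(B₀) ⊆ B₀ is given; finite dimensionality turns it into the equivalence that `Aut`
  -- requires.
  let f : S.Aut := ⟨a, ha, JonesTower.apply_mem_iff_of_finiteDimensional a B₀ haB⟩
  refine ⟨f.bInf, ⟨f.trInf_bInf, f.bInf_jones, f.bInf_image_level, f.bInf_toBInf 0⟩, ?_⟩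
  rintro α ⟨htrα, hjones, -, h0⟩
  exact f.eq_bInf htrα hjones h0
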